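/- Let $E$ be a real Banach space, $H$ a real Hilbert space, $B\in\mathscr L(H,E)$, and let $S=\{S(t)\}_{t\ge 0}$ be a $C_0$-semigroup on $E$ with generator $A$. A *Gaussian measure* is a centred Gaussian Radon measure; $R\in\mathscr L(E^*,E)$ is the covariance operator of the Gaussian measure $\mu$ on $E$ if $\langle Rx^*,y^*\rangle=\int_E\langle x,x^*\rangle\langle x,y^*\rangle\,d\mu(x)$ for all $x^*,y^*\in E^*$. Assume that for every $t\ge 0$ there is a Gaussian measure $\mu_t$ on $E$ whose covariance operator $Q_t\in\mathscr L(E^*,E)$ is given by $$\langle Q_tx^*,y^*\rangle=\int_0^t\langle S(s)BB^*S^*(s)x^*,y^*\rangle\,ds,\qquad x^*,y^*\in E^*.$$ Assume that the limit $Q_\infty=\lim_{t\to\infty}Q_t$ exists in the weak operator topology of $\mathscr L(E^*,E)$ and that it is the covariance operator of a Gaussian measure $\mu_\infty$ on $E$. Let $P=\{P(t)\}_{t\ge 0}$ be the Ornstein-Uhlenbeck semigroup, defined for bounded continuous $f:E\to\mathbb R$ by $$P(t)f(x)=\int_E f(S(t)x+y)\,d\mu_t(y),\qquad x\in E.$$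 Let $E_\infty$ be the closure in $E$ of the range of $Q_\infty$ (equivalently, the support of $\mu_\infty$), which is a closed $S$-invariant subspace of $E$, and let $A_\infty$ be the part of $A$ in $E_\infty$, i.e. the generator of the restriction of $S$ to $E_\infty$. Suppose that $S$ is eventually compact ($S(t_0)$ is a compact operator for some $t_0>0$) and that $A_\infty$ (after complexification) has non-empty spectrum, $\sigma(A_\infty)\ne\emptyset$. (If $\mu_\infty$ is nondegenerate, i.e. $Q_\infty$ has dense range, then $A_\infty=A$ and this condition reads $\sigma(A)\neq\emptyset$.) Then every $P(t)$ extends uniquely to a bounded linear operator, again denoted by $P(t)$, on the real space $L^1(E,\mu_\infty)$, and $$\|P(t)-P(s)\|_{\mathscr L(L^1(E,\mu_\infty))}=2\qquad\text{for all } t,s\ge 0 \text{ with } t\neq s.$$ -/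

import Mathlib

open MeasureTheory ProbabilityTheory Filter Topology
open scoped NNReal ENNReal BoundedContinuousFunction

noncomputable section

namespace OrnsteinUhlenbeck

/-- A `C₀`-semigroup of bounded linear operators on a real Banach space `E`. -/
structure C0Semigroup (E : Type*) [NormedAddCommGroup E] [NormedSpace ℝ E] where
  toFun : ℝ≥0 → E →L[ℝ] E
  map_zero' : toFun 0 = ContinuousLinearMap.id ℝ E
  map_add' : ∀ s t, toFun (s + t) = (toFun s).comp (toFun t)
  tendsto_zero' : ∀ x, Tendsto (fun t => toFun t x) (𝓝 0) (𝓝 x)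

section Semigroup

variable {E : Type*} [NormedAddCommGroup E] [NormedSpace ℝ E]

instance : CoeFun (C0Semigroup E) (fun _ => ℝ≥0 → E →L[ℝ] E) := ⟨C0Semigroup.toFun⟩

/-- `S` is eventually compact: `S t₀` is a compact operator for some `t₀ > 0`. -/
def C0Semigroup.EventuallyCompact (S : C0Semigroup E) : Prop :=
  ∃ t₀ : ℝ≥0, 0 < t₀ ∧ IsCompactOperator (S t₀)

/-- `x` lies in the domain of the generator of `S`, and the generator maps `x` to `y`:
the difference quotients `t⁻¹ (S t x - x)` converge in norm to `y` as `t ↓ 0`. -/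
def C0Semigroup.GeneratorRel (S : C0Semigroup E) (x y : E) : Prop :=
  Tendsto (fun t : ℝ => t⁻¹ • (S t.toNNReal x - x)) (𝓝[>] 0) (𝓝 y)

theorem C0Semigroup.GeneratorRel.add {S : C0Semigroup E} {x x' y y' : E}
    (h : S.GeneratorRel x y) (h' : S.GeneratorRel x' y') :
    S.GeneratorRel (x + x') (y + y') := by
  refine (Tendsto.add h h').congr fun t => ?_
  rw [← smul_add, map_add]
  congr 1
  abel

theorem C0Semigroup.GeneratorRel.smul {S : C0Semigroup E} {x y : E} (c : ℝ)
    (h : S.GeneratorRel x y) : S.GeneratorRel (c • x) (c • y) := by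
  refine (Tendsto.const_smul h c).congr fun t => ?_
  rw [map_smul, ← smul_sub, smul_comm]

theorem C0Semigroup.GeneratorRel.zero (S : C0Semigroup E) : S.GeneratorRel 0 0 := by
  simp [C0Semigroup.GeneratorRel]

theorem C0Semigroup.GeneratorRel.unique {S : C0Semigroup E} {x y y' : E}
    (h : S.GeneratorRel x y) (h' : S.GeneratorRel x y') : y = y' :=
  tendsto_nhds_unique h h'

/-- The (infinitesimal) generator of `S`, as an unbounded operator on `E`. -/
def C0Semigroup.generator (S : C0Semigroup E) : E →ₗ.[ℝ] E where
  domain :=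
    { carrier := {x | ∃ y, S.GeneratorRel x y}
      add_mem' := fun ⟨_, h⟩ ⟨_, h'⟩ => ⟨_, h.add h'⟩
      zero_mem' := ⟨0, C0Semigroup.GeneratorRel.zero S⟩
      smul_mem' := fun c _ ⟨_, h⟩ => ⟨_, h.smul c⟩ }
  toFun :=
    { toFun := fun x => Classical.choose x.2
      map_add' := fun x x' => (Classical.choose_spec (x + x').2).unique
        ((Classical.choose_spec x.2).add (Classical.choose_spec x'.2))
      map_smul' := fun c x => (Classical.choose_spec (c • x).2).unique
        ((Classical.choose_spec x.2).smul c) }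

theorem C0Semigroup.generatorRel_generator (S : C0Semigroup E) (x : S.generator.domain) :
    S.GeneratorRel x (S.generator x) :=
  Classical.choose_spec x.2

/-- The part of the unbounded operator `A` in the subspace `F`: its domain consists of those
`x ∈ D(A) ∩ F` with `A x ∈ F`, and there it acts as `A`. When `A` generates a `C₀`-semigroup `S`
and `F` is closed and `S`-invariant, this is the generator of the restriction of `S` to `F`. -/
def partIn (A : E →ₗ.[ℝ] E) (F : Submodule ℝ E) : F →ₗ.[ℝ] F where
  domain :=
    { carrier := {x | ∃ hx : (x : E) ∈ A.domain, A ⟨x, hx⟩ ∈ F}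
      add_mem' := fun {x y} ⟨hx, hx'⟩ ⟨hy, hy'⟩ => ⟨A.domain.add_mem hx hy, by
        have h := A.map_add ⟨x, hx⟩ ⟨y, hy⟩
        have h' := F.add_mem hx' hy'
        rw [← h] at h'
        exact h'⟩
      zero_mem' := ⟨A.domain.zero_mem, by
        have h := A.map_zero
        have h' := F.zero_mem
        rw [← h] at h'
        exact h'⟩
      smul_mem' := fun c x ⟨hx, hx'⟩ => ⟨A.domain.smul_mem c hx, by
        have h := A.map_smul c ⟨x, hx⟩
        have h' := F.smul_mem c hx'
        rw [← h] at h'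
        exact h'⟩ }
  toFun :=
    { toFun := fun x => ⟨A ⟨x, x.2.1⟩, x.2.2⟩
      map_add' := fun x y => Subtype.ext (A.map_add ⟨x, x.2.1⟩ ⟨y, y.2.1⟩)
      map_smul' := fun c x => Subtype.ext (A.map_smul c ⟨x, x.2.1⟩) }

/-- The operator `z - A` on the complexification: an element `u + i v` of the complexification of
`E` is written as the pair `(u, v)`, and `z - A` is
`u + i v ↦ (a u - b v - A u) + i (b u + a v - A v)` for `z = a + i b` and `u, v ∈ D(A)`. -/
def complexSub (z : ℂ) (A : E →ₗ.[ℝ] E) (p : A.domain × A.domain) : E × E :=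
  (z.re • (p.1 : E) - z.im • (p.2 : E) - A p.1, z.im • (p.1 : E) + z.re • (p.2 : E) - A p.2)

/-- The spectrum `σ(A) ⊆ ℂ` of (the complexification of) a closed operator `A` on a real Banach
space: the set of all `z` for which `z - A` is not a bijection from the (complexified) domain onto
the (complexified) space. -/
def complexSpectrum (A : E →ₗ.[ℝ] E) : Set ℂ :=
  {z | ¬ Function.Bijective (complexSub z A)}

end Semigroup

section Gaussian

variable {E : Type*} [NormedAddCommGroup E] [NormedSpace ℝ E] [MeasurableSpace E]

/-- `μ` is a centred Gaussian Radon measure on `E` with covariance operator `R : E* → E`, that is,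
`⟨R x*, y*⟩ = ∫ ⟨x, x*⟩ ⟨x, y*⟩ dμ(x)`. -/
structure IsCenteredGaussianRadon (μ : Measure E) (R : StrongDual ℝ E →L[ℝ] E) : Prop where
  isGaussian : IsGaussian μ
  radon : μ.InnerRegular
  centered : ∀ f : StrongDual ℝ E, ∫ x, f x ∂μ = 0
  covariance : ∀ f g : StrongDual ℝ E, g (R f) = ∫ x, f x * g x ∂μ

end Gaussian

section OU

variable {E : Type*} [NormedAddCommGroup E] [NormedSpace ℝ E]
  {H : Type*} [NormedAddCommGroup H] [InnerProductSpace ℝ H] [CompleteSpace H]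

/-- The operator `Q = B B* : E* → E`, where `B* : E* → H* = H` (Riesz identification). -/
def noiseCov (B : H →L[ℝ] E) (f : StrongDual ℝ E) : E :=
  B ((InnerProductSpace.toDual ℝ H).symm (f.comp B))

/-- `R : E* → E` is the operator `Q_t` given by
`⟨Q_t x*, y*⟩ = ∫₀ᵗ ⟨S(s) B B* S(s)* x*, y*⟩ ds`. -/
def IsOUCovariance (S : C0Semigroup E) (B : H →L[ℝ] E) (t : ℝ≥0)
    (R : StrongDual ℝ E →L[ℝ] E) : Prop :=
  ∀ f g : StrongDual ℝ E,
    g (R f) = ∫ s in (0 : ℝ)..t, g (S s.toNNReal (noiseCov B (f.comp (S s.toNNReal))))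

/-- The bounded operator `T` on `L¹(E, ν)` extends the Ornstein-Uhlenbeck operator
`P(t) f (x) = ∫ f (S(t) x + y) dμ_t(y)`, `f ∈ C_b(E)`; here `μt` is the measure `μ_t`. -/
def ExtendsOU [MeasurableSpace E] (S : C0Semigroup E) (t : ℝ≥0) (μt ν : Measure E)
    (T : Lp ℝ 1 ν →L[ℝ] Lp ℝ 1 ν) : Prop :=
  ∀ (f : E →ᵇ ℝ) (u : Lp ℝ 1 ν), u =ᵐ[ν] f →
    T u =ᵐ[ν] fun x => ∫ y, f (S t x + y) ∂μt

end OU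

end OrnsteinUhlenbeck

end

/-! Write q(g) for the variance ⟨Q∞g, g⟩. Cutting the integral for Q_r+t at t and letting r → ∞
gives q(g) = ⟨Q_t g, g⟩ + q(g∘S(t)) (`covariance_limit_eq`). Hence μ∞ is invariant and each P(t) is
an L¹-contraction on bounded continuous functions, which are dense; so the extension exists, is
unique, and the distances are at most 2.

For the lower bound, P(t) maps the unit vector exp(g − q(g)/2) to the same expression for g∘S(t)
(`ExtendsOU.apply_wickExp`). These are densities of translates of μ∞, and the Hellinger estimate
`le_norm_toL1_wickExp_sub` bounds the distance of two images below by 2 − 2exp(−d/8), with d =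
q(g∘S(t) − g∘S(s)). Replacing g by r·g multiplies d by r², so one g with d > 0 suffices.

If no such g existed, S(t) and S(s) would agree on E∞. For s < t and p = t − s, q(g∘S(s+np)) would
then be independent of n; but it tends to 0 because Q_t → Q∞. So S(s) = 0 on E∞, and a nilpotent
semigroup has a generator with empty spectrum (`complexSpectrum_partIn_eq_empty`), a contradiction.
-/

namespace OrnsteinUhlenbeck

/-! ### C₀-semigroups, and the empty spectrum in the nilpotent case. -/

section Semigroup

variable {E : Type*} [NormedAddCommGroup E] [NormedSpace ℝ E]

theorem C0Semigroup.map_zero (S : C0Semigroup E) (x : E) : S 0 x = x := by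
  rw [S.map_zero']; rfl

theorem C0Semigroup.map_add (S : C0Semigroup E) (s t : ℝ≥0) (x : E) :
    S (s + t) x = S s (S t x) := by
  rw [S.map_add']; rfl

theorem C0Semigroup.exists_bound_nhds_zero [CompleteSpace E] (S : C0Semigroup E) :
    ∃ δ : ℝ≥0, 0 < δ ∧ ∃ M : ℝ, ∀ t ≤ δ, ‖S t‖ ≤ M := by
  by_contra! h
  have h0 (n : ℕ) : (0 : ℝ≥0) < 1 / ((n : ℝ≥0) + 1) := by positivity
  choose t ht hM using fun n : ℕ => h _ (h0 n) n
  have htend : Tendsto t atTop (𝓝 0) :=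
    tendsto_of_tendsto_of_tendsto_of_le_of_le tendsto_const_nhds
      tendsto_one_div_add_atTop_nhds_zero_nat (fun _ => zero_le) ht
  obtain ⟨C, hC⟩ := banach_steinhaus (g := fun n => S (t n)) fun x => by
    obtain ⟨C, hC⟩ := ((S.tendsto_zero' x).comp htend).norm.bddAbove_range
    exact ⟨C, fun n => hC ⟨n, rfl⟩⟩
  obtain ⟨n, hn⟩ := exists_nat_gt C
  exact absurd (hC n) (not_le.2 (hn.trans (hM n)))

theorem C0Semigroup.exists_bound [CompleteSpace E] (S : C0Semigroup E) (T : ℝ≥0) :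
    ∃ M : ℝ, ∀ t ≤ T, ‖S t‖ ≤ M := by
  obtain ⟨δ, hδ, M, hM⟩ := S.exists_bound_nhds_zero
  have key (n : ℕ) : ∃ M : ℝ, ∀ t ≤ n * δ, ‖S t‖ ≤ M := by
    induction n with
    | zero =>
      refine ⟨‖S 0‖, fun t ht => ?_⟩
      have : t = 0 := by simpa using ht
      rw [this]
    | succ n ih =>
      obtain ⟨M', hM'⟩ := ih
      refine ⟨max M' (M' * M), fun t ht => ?_⟩
      rcases le_total t (n * δ) with h | h
      · exact (hM' t h).trans (le_max_left _ _)
      · obtain ⟨r, rfl⟩ := exists_add_of_le h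
        have hr : r ≤ δ := by
          have : n * δ + r ≤ n * δ + δ := by simpa [add_mul] using ht
          exact le_of_add_le_add_left this
        rw [S.map_add']
        refine ((S (n * δ)).opNorm_comp_le (S r)).trans (le_max_of_le_right ?_)
        exact mul_le_mul (hM' _ le_rfl) (hM r hr) (norm_nonneg _)
          ((norm_nonneg _).trans (hM' _ le_rfl))
  obtain ⟨n, hn⟩ := exists_nat_ge (T / δ)
  obtain ⟨M', hM'⟩ := key n
  exact ⟨M', fun t ht => hM' t (ht.trans ((div_le_iff₀ hδ).1 hn))⟩

theorem C0Semigroup.continuous_apply [CompleteSpace E] (S : C0Semigroup E) (x : E) :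
    Continuous fun t => S t x := by
  refine continuous_iff_continuousAt.2 fun t₀ => ?_
  obtain ⟨M, hM⟩ := S.exists_bound (t₀ + 1)
  have hM0 : 0 ≤ M := (norm_nonneg _).trans (hM 0 zero_le)
  -- With truncated subtraction, (t - t₀) + (t₀ - t) is |t - t₀|, so one bound serves both sides:
  -- factor out the operator at the smaller time.
  have hbound : ∀ t ≤ t₀ + 1, ‖S t x - S t₀ x‖ ≤ M * ‖S ((t - t₀) + (t₀ - t)) x - x‖ := by
    intro t ht
    rcases le_total t t₀ with h | h
    · obtain ⟨r, rfl⟩ := exists_add_of_le h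
      rw [tsub_eq_zero_of_le h, zero_add, add_tsub_cancel_left, S.map_add, ← map_sub, ← norm_neg,
        ← map_neg, neg_sub]
      exact (S t).le_of_opNorm_le (hM t ht) _
    · obtain ⟨r, rfl⟩ := exists_add_of_le h
      rw [tsub_eq_zero_of_le h, add_zero, add_tsub_cancel_left, S.map_add, ← map_sub]
      exact (S t₀).le_of_opNorm_le (hM t₀ (by simp)) _
  refine tendsto_iff_norm_sub_tendsto_zero.2 ?_
  have hlim : Tendsto (fun t => M * ‖S ((t - t₀) + (t₀ - t)) x - x‖) (𝓝 t₀) (𝓝 0) := by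
    have h1 : Tendsto (fun t : ℝ≥0 => (t - t₀) + (t₀ - t)) (𝓝 t₀) (𝓝 0) := by
      have : Continuous fun t : ℝ≥0 => (t - t₀) + (t₀ - t) := by fun_prop
      simpa using this.tendsto t₀
    have h2 := ((S.tendsto_zero' x).comp h1).sub_const x
    simpa using (h2.norm.const_mul M)
  refine squeeze_zero' (Eventually.of_forall fun _ => norm_nonneg _) ?_ hlim
  filter_upwards [Iio_mem_nhds (show t₀ < t₀ + 1 by simp)] with t ht using hbound t ht.le

theorem C0Semigroup.continuous_toNNReal_apply [CompleteSpace E] (S : C0Semigroup E) (x : E) :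
    Continuous fun t : ℝ => S t.toNNReal x :=
  (S.continuous_apply x).comp continuous_real_toNNReal

theorem C0Semigroup.generatorRel_iff_hasDerivWithinAt (S : C0Semigroup E) {x y : E} :
    S.GeneratorRel x y ↔ HasDerivWithinAt (fun t : ℝ => S t.toNNReal x) y (Set.Ici 0) 0 := by
  rw [← hasDerivWithinAt_Ioi_iff_Ici, hasDerivWithinAt_iff_tendsto_slope' (by simp)]
  simp only [GeneratorRel, slope_fun_def, sub_zero, Real.toNNReal_zero, S.map_zero, vsub_eq_sub]

/-- A vector that the generator maps to zero is fixed by the semigroup. -/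
theorem C0Semigroup.GeneratorRel.apply_eq_self [CompleteSpace E] {S : C0Semigroup E} {x : E}
    (h : S.GeneratorRel x 0) (t : ℝ≥0) : S t x = x := by
  -- The right derivative of the orbit at r is S r applied to the one at 0, hence zero.
  have hderiv : ∀ r ∈ Set.Ico (0 : ℝ) t,
      HasDerivWithinAt (fun t : ℝ => S t.toNNReal x) 0 (Set.Ici r) r := by
    rintro r ⟨hr, -⟩
    rw [← hasDerivWithinAt_Ioi_iff_Ici, hasDerivWithinAt_iff_tendsto_slope' (by simp)]
    have h1 := ((S r.toNNReal).continuous.tendsto _).comp h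
    have h2 : Tendsto (fun u : ℝ => u - r) (𝓝[>] r) (𝓝[>] 0) := by
      refine tendsto_nhdsWithin_iff.2 ⟨?_, ?_⟩
      · have : Tendsto (fun u : ℝ => u - r) (𝓝 r) (𝓝 (r - r)) := tendsto_id.sub_const r
        rw [sub_self] at this
        exact this.mono_left nhdsWithin_le_nhds
      · filter_upwards [self_mem_nhdsWithin] with u hu
        simpa using hu
    have h3 := h1.comp h2
    rw [_root_.map_zero] at h3
    refine h3.congr' ?_
    filter_upwards [self_mem_nhdsWithin] with u hu
    have hu' : r < u := hu
    have : u.toNNReal = r.toNNReal + (u - r).toNNReal := by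
      rw [← Real.toNNReal_add hr (by linarith)]; congr 1; ring
    simp [slope_fun_def, this, S.map_add]
  have := constant_of_has_deriv_right_zero (S.continuous_toNNReal_apply x).continuousOn hderiv
    t ⟨t.2, le_rfl⟩
  simpa [S.map_zero] using this

/-- If `S s p = 0`, then `-∫₀ˢ S r p dr` is mapped by the generator to `p`. -/
theorem C0Semigroup.generatorRel_neg_integral [CompleteSpace E] (S : C0Semigroup E) {s : ℝ≥0}
    {p : E} (hp : S s p = 0) :
    S.GeneratorRel (-∫ r in (0 : ℝ)..s, S r.toNNReal p) p := by
  have hc := S.continuous_toNNReal_apply p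
  have hint (a b : ℝ) : IntervalIntegrable (fun r : ℝ => S r.toNNReal p) volume a b :=
    hc.intervalIntegrable a b
  have hzero : ∀ r : ℝ, (s : ℝ) ≤ r → S r.toNNReal p = 0 := by
    intro r hr
    obtain ⟨w, hw⟩ := exists_add_of_le (show s ≤ r.toNNReal from NNReal.le_toNNReal_of_coe_le hr)
    rw [hw, add_comm, S.map_add, hp, _root_.map_zero]
  have hderiv : HasDerivWithinAt (fun t : ℝ => ∫ r in (0 : ℝ)..t, S r.toNNReal p) p
      (Set.Ici 0) 0 := by
    have := (hc.integral_hasStrictDerivAt 0 0).hasDerivAt.hasDerivWithinAt (s := Set.Ici 0)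
    simpa [S.map_zero] using this
  rw [S.generatorRel_iff_hasDerivWithinAt]
  -- For t ≥ 0, S t carries -∫₀ˢ to -∫ₜˢ⁺ᵗ, which equals ∫₀ᵗ - ∫₀ˢ because the orbit vanishes after
  -- time s.
  refine (hderiv.sub_const (∫ r in (0 : ℝ)..s, S r.toNNReal p)).congr_of_mem ?_ (by simp)
  intro t ht
  have ht' : (0 : ℝ) ≤ t := ht
  rw [_root_.map_neg, ← (S t.toNNReal).intervalIntegral_comp_comm (hint _ _)]
  have h1 : ∫ r in (0 : ℝ)..s, S t.toNNReal (S r.toNNReal p)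
      = ∫ r in (0 : ℝ)..s, S (r + t).toNNReal p := by
    refine intervalIntegral.integral_congr fun r hr => ?_
    rw [Set.uIcc_of_le s.coe_nonneg] at hr
    rw [← S.map_add, ← Real.toNNReal_add ht' hr.1, add_comm]
  have h2 : ∫ r in (s : ℝ)..(s + t), S r.toNNReal p = 0 := by
    rw [intervalIntegral.integral_congr (g := fun _ => (0 : E)), intervalIntegral.integral_zero]
    intro r hr
    rw [Set.uIcc_of_le (by linarith)] at hr
    exact hzero r hr.1
  rw [h1, intervalIntegral.integral_comp_add_right (fun r => S r.toNNReal p), zero_add]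
  have h3 := intervalIntegral.integral_add_adjacent_intervals (hint 0 t) (hint t (s + t))
  have h4 := intervalIntegral.integral_add_adjacent_intervals (hint 0 s) (hint s (s + t))
  rw [h2, add_zero] at h4
  rw [h4, ← h3]
  abel

/-- Multiplication by `c + i d` on the complexification `E × E`. -/
noncomputable def complexMul (c d : ℝ) : E × E →L[ℝ] E × E :=
  (c • ContinuousLinearMap.fst ℝ E E - d • ContinuousLinearMap.snd ℝ E E).prod
    (d • ContinuousLinearMap.fst ℝ E E + c • ContinuousLinearMap.snd ℝ E E)

@[simp]
theorem complexMul_apply (c d : ℝ) (p : E × E) :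
    complexMul c d p = (c • p.1 - d • p.2, d • p.1 + c • p.2) := rfl

/-- The semigroup `t ↦ exp (-t z) S(t)` on the complexification `E × E`. -/
noncomputable def C0Semigroup.complexRescale (S : C0Semigroup E) (z : ℂ) : C0Semigroup (E × E) where
  toFun t := (complexMul (Complex.exp (-(t : ℝ) * z)).re (Complex.exp (-(t : ℝ) * z)).im).comp
    ((S t).prodMap (S t))
  map_zero' := by
    ext p <;> simp [S.map_zero]
  map_add' s t := by
    have : Complex.exp (-((s + t : ℝ≥0) : ℝ) * z)
        = Complex.exp (-(s : ℝ) * z) * Complex.exp (-(t : ℝ) * z) := by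
      rw [← Complex.exp_add]; congr 1; push_cast; ring
    rw [this]
    generalize Complex.exp (-(s : ℝ) * z) = a
    generalize Complex.exp (-(t : ℝ) * z) = b
    ext p <;>
    · simp [S.map_add, Complex.mul_re, Complex.mul_im]
      module
  tendsto_zero' p := by
    have hexp : Continuous fun t : ℝ≥0 => Complex.exp (-(t : ℝ) * z) := by fun_prop
    have hre := (Complex.continuous_re.comp hexp).tendsto 0
    have him := (Complex.continuous_im.comp hexp).tendsto 0
    simp only [Function.comp_def, NNReal.coe_zero, Complex.ofReal_zero, neg_zero, zero_mul,
      Complex.exp_zero, Complex.one_re, Complex.one_im] at hre him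
    have h1 := S.tendsto_zero' p.1
    have h2 := S.tendsto_zero' p.2
    have := ((hre.smul h1).sub (him.smul h2)).prodMk_nhds ((him.smul h1).add (hre.smul h2))
    simpa using this

theorem C0Semigroup.complexRescale_apply (S : C0Semigroup E) (z : ℂ) (t : ℝ≥0) (p : E × E) :
    S.complexRescale z t p = complexMul (Complex.exp (-(t : ℝ) * z)).re
      (Complex.exp (-(t : ℝ) * z)).im (S t p.1, S t p.2) := rfl

theorem hasDerivAt_exp_neg_mul_re_im (z : ℂ) :
    HasDerivAt (fun t : ℝ => (Complex.exp (-t * z)).re) (-z.re) 0 ∧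
      HasDerivAt (fun t : ℝ => (Complex.exp (-t * z)).im) (-z.im) 0 := by
  have h : HasDerivAt (fun t : ℝ => Complex.exp (-t * z)) (-z) 0 := by
    have h1 : HasDerivAt (fun t : ℝ => -(t : ℂ) * z) (-1 * z) 0 :=
      (Complex.ofRealCLM.hasDerivAt (x := (0 : ℝ))).neg.mul_const z
    simpa using h1.cexp
  constructor
  · exact Complex.reCLM.hasFDerivAt.comp_hasDerivAt (0 : ℝ) h
  · exact Complex.imCLM.hasFDerivAt.comp_hasDerivAt (0 : ℝ) h

/-- Product rule: exp(-tz)S(t) has generator A - z, so spectral questions at z become questions at 0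
for the rescaled semigroup. -/
theorem C0Semigroup.GeneratorRel.complexRescale {S : C0Semigroup E} {u v y w : E}
    (hu : S.GeneratorRel u y) (hv : S.GeneratorRel v w) (z : ℂ) :
    (S.complexRescale z).GeneratorRel (u, v)
      (-(z.re • u - z.im • v - y), -(z.im • u + z.re • v - w)) := by
  rw [C0Semigroup.generatorRel_iff_hasDerivWithinAt] at *
  obtain ⟨hre, him⟩ := hasDerivAt_exp_neg_mul_re_im z
  have hre := hre.hasDerivWithinAt (s := Set.Ici 0)
  have him := him.hasDerivWithinAt (s := Set.Ici 0)
  refine ((((hre.smul hu).sub (him.smul hv)).prodMk ((him.smul hu).add (hre.smul hv))).congr_of_mem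
    (fun t (ht : 0 ≤ t) => ?_) (by simp)).congr_deriv ?_
  · simp [complexRescale_apply, ht]
  · simp [S.map_zero]
    constructor <;> module

/-- Multiplying by exp(tz) recovers S, and the product rule applies again. -/
theorem C0Semigroup.GeneratorRel.of_complexRescale {S : C0Semigroup E} {u v y w : E} {z : ℂ}
    (h : (S.complexRescale z).GeneratorRel (u, v) (y, w)) :
    S.GeneratorRel u (z.re • u - z.im • v + y) ∧ S.GeneratorRel v (z.im • u + z.re • v + w) := by
  have hback (t : ℝ) (ht : 0 ≤ t) : (S t.toNNReal u, S t.toNNReal v) =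
      complexMul (Complex.exp (-t * -z)).re (Complex.exp (-t * -z)).im
        (S.complexRescale z t.toNNReal (u, v)) := by
    have hexp : Complex.exp (-t * -z) * Complex.exp (-t * z) = 1 := by
      rw [← Complex.exp_add]; simp
    rw [complexRescale_apply, Real.coe_toNNReal t ht]
    generalize Complex.exp (-t * -z) = a at *
    generalize Complex.exp (-t * z) = b at *
    have hre : a.re * b.re - a.im * b.im = 1 := by simpa using congrArg Complex.re hexp
    have him : a.re * b.im + a.im * b.re = 0 := by simpa using congrArg Complex.im hexp
    generalize S t.toNNReal u = u'
    generalize S t.toNNReal v = v'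
    refine Prod.ext ?_ ?_
    · calc u' = (a.re * b.re - a.im * b.im) • u' - (a.re * b.im + a.im * b.re) • v' := by
            rw [hre, him]; simp
        _ = _ := by simp; module
    · calc v' = (a.re * b.re - a.im * b.im) • v' + (a.re * b.im + a.im * b.re) • u' := by
            rw [hre, him]; simp
        _ = _ := by simp; module
  simp only [C0Semigroup.generatorRel_iff_hasDerivWithinAt] at *
  obtain ⟨hre, him⟩ := hasDerivAt_exp_neg_mul_re_im (-z)
  have hre := hre.hasDerivWithinAt (s := Set.Ici 0)
  have him := him.hasDerivWithinAt (s := Set.Ici 0)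
  have h1 : HasDerivWithinAt (fun t : ℝ => (S.complexRescale z t.toNNReal (u, v)).1) y
      (Set.Ici 0) 0 :=
    (ContinuousLinearMap.fst ℝ E E).hasFDerivAt.comp_hasDerivWithinAt (0 : ℝ) h
  have h2 : HasDerivWithinAt (fun t : ℝ => (S.complexRescale z t.toNNReal (u, v)).2) w
      (Set.Ici 0) 0 :=
    (ContinuousLinearMap.snd ℝ E E).hasFDerivAt.comp_hasDerivWithinAt (0 : ℝ) h
  constructor
  · refine (((hre.smul h1).sub (him.smul h2)).congr_of_mem
      (fun t (ht : 0 ≤ t) => ?_) (by simp)).congr_deriv ?_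
    · exact congrArg Prod.fst (hback t ht)
    · simp [C0Semigroup.map_zero]
      module
  · refine (((him.smul h1).add (hre.smul h2)).congr_of_mem
      (fun t (ht : 0 ≤ t) => ?_) (by simp)).congr_deriv ?_
    · exact congrArg Prod.snd (hback t ht)
    · simp [C0Semigroup.map_zero]
      module

theorem C0Semigroup.GeneratorRel.mem_domain {S : C0Semigroup E} {x y : E}
    (h : S.GeneratorRel x y) : x ∈ S.generator.domain := ⟨y, h⟩

theorem C0Semigroup.GeneratorRel.generator_apply {S : C0Semigroup E} {x y : E}
    (h : S.GeneratorRel x y) (hx : x ∈ S.generator.domain) : S.generator ⟨x, hx⟩ = y :=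
  (S.generatorRel_generator ⟨x, hx⟩).unique h

theorem intervalIntegral_mem_of_isClosed [CompleteSpace E] {F : Submodule ℝ E}
    (hF : IsClosed (F : Set E)) {f : ℝ → E} (hf : Continuous f) (hmem : ∀ t, f t ∈ F) (a b : ℝ) :
    ∫ t in a..b, f t ∈ F := by
  have : CompleteSpace F := hF.completeSpace_coe
  have h : ∫ t in a..b, f t = F.subtypeL (∫ t in a..b, (⟨f t, hmem t⟩ : F)) := by
    rw [← ContinuousLinearMap.intervalIntegral_comp_comm]
    · rfl
    · exact (hf.subtype_mk hmem).intervalIntegrable a b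
  rw [h]
  exact Subtype.mem _

/-- The generator of a nilpotent semigroup has empty spectrum. -/
theorem complexSpectrum_partIn_eq_empty [CompleteSpace E] (S : C0Semigroup E) {F : Submodule ℝ E}
    (hF : IsClosed (F : Set E)) (hinv : ∀ t, ∀ x ∈ F, S t x ∈ F) {s : ℝ≥0}
    (hs : ∀ x ∈ F, S s x = 0) : complexSpectrum (partIn S.generator F) = ∅ := by
  refine Set.eq_empty_of_forall_notMem fun z hz => hz ?_
  have hrel (p : (partIn S.generator F).domain × (partIn S.generator F).domain) :
      (S.complexRescale z).GeneratorRel ((p.1 : F), (p.2 : F))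
        (-((complexSub z (partIn S.generator F) p).1 : E),
          -((complexSub z (partIn S.generator F) p).2 : E)) :=
    (S.generatorRel_generator ⟨_, p.1.2.1⟩).complexRescale
      (S.generatorRel_generator ⟨_, p.2.2.1⟩) z
  have hzero (x y : F) : S.complexRescale z s (x, y) = 0 := by
    simp [C0Semigroup.complexRescale_apply, hs]
  constructor
  -- The difference of two preimages is killed by the rescaled generator, so it is fixed by a
  -- semigroup that vanishes at time s.
  · intro p p' hpp
    have h := (hrel p).add ((hrel p').smul (-1))
    rw [hpp] at h
    have h0 : ((-((complexSub z (partIn S.generator F) p').1 : E),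
          -((complexSub z (partIn S.generator F) p').2 : E)) : E × E) + (-1 : ℝ) •
          (-((complexSub z (partIn S.generator F) p').1 : E),
          -((complexSub z (partIn S.generator F) p').2 : E)) = 0 := by
      simp
    rw [h0] at h
    have h1 := h.apply_eq_self s
    rw [_root_.map_add, _root_.map_smul, hzero, hzero] at h1
    simp only [smul_zero, add_zero] at h1
    have h2 := congrArg Prod.fst h1
    have h3 := congrArg Prod.snd h1
    simp only [Prod.fst_zero, Prod.snd_zero, neg_smul, one_smul, ← sub_eq_add_neg] at h2 h3
    refine Prod.ext (Subtype.ext (Subtype.ext ?_)) (Subtype.ext (Subtype.ext ?_))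
    · exact sub_eq_zero.1 h2.symm
    · exact sub_eq_zero.1 h3.symm
  -- The preimage is the Laplace transform of the orbit, which nilpotency cuts off at s: ∫₀ˢ
  -- exp(-rz)S(r)(x + iy) dr.
  · rintro ⟨x, y⟩
    set T := S.complexRescale z
    have hmem (t : ℝ≥0) : T t (x, y) ∈ F.prod F := by
      have hx := hinv t x x.2
      have hy := hinv t y y.2
      exact ⟨F.sub_mem (F.smul_mem _ hx) (F.smul_mem _ hy),
        F.add_mem (F.smul_mem _ hx) (F.smul_mem _ hy)⟩
    have hI : -∫ r in (0 : ℝ)..s, T r.toNNReal (x, y) ∈ F.prod F :=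
      neg_mem (intervalIntegral_mem_of_isClosed (hF.prod hF) (T.continuous_toNNReal_apply _)
        (fun t => hmem _) _ _)
    have hgen := T.generatorRel_neg_integral (hzero x y)
    obtain ⟨⟨u, v⟩, huv⟩ : ∃ q : E × E, q = ∫ r in (0 : ℝ)..s, T r.toNNReal (x, y) := ⟨_, rfl⟩
    rw [← huv] at hI hgen
    have hu : u ∈ F := by simpa using hI.1
    have hv : v ∈ F := by simpa using hI.2
    have hgen' := hgen.smul (-1)
    simp only [neg_smul, one_smul, neg_neg] at hgen'
    obtain ⟨h1, h2⟩ := hgen'.of_complexRescale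
    have hu' : (⟨u, hu⟩ : F) ∈ (partIn S.generator F).domain := by
      refine ⟨h1.mem_domain, (h1.generator_apply h1.mem_domain).symm ▸ ?_⟩
      exact F.add_mem (F.sub_mem (F.smul_mem _ hu) (F.smul_mem _ hv)) (F.neg_mem x.2)
    have hv' : (⟨v, hv⟩ : F) ∈ (partIn S.generator F).domain := by
      refine ⟨h2.mem_domain, (h2.generator_apply h2.mem_domain).symm ▸ ?_⟩
      exact F.add_mem (F.add_mem (F.smul_mem _ hu) (F.smul_mem _ hv)) (F.neg_mem y.2)
    refine ⟨(⟨_, hu'⟩, ⟨_, hv'⟩), Prod.ext (Subtype.ext ?_) (Subtype.ext ?_)⟩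
    · change z.re • u - z.im • v - S.generator ⟨u, _⟩ = x
      rw [h1.generator_apply]
      abel
    · change z.im • u + z.re • v - S.generator ⟨v, _⟩ = y
      rw [h2.generator_apply]
      abel

end Semigroup

/-! ### Radon measures and convolution without separability of the space. -/

section Radon

variable {E : Type*} [NormedAddCommGroup E] [MeasurableSpace E]

/-- A finite Radon measure on a metric space is concentrated on a separable set. -/
theorem exists_isSeparable_measure_compl_eq_zero [BorelSpace E] (μ : Measure E)
    [IsFiniteMeasure μ] [μ.InnerRegular] :
    ∃ s : Set E, TopologicalSpace.IsSeparable s ∧ μ sᶜ = 0 := by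
  have h (n : ℕ) : ∃ K : Set E, IsCompact K ∧ μ Kᶜ < ((n : ℝ≥0∞) + 1)⁻¹ := by
    obtain ⟨K, -, hK, h⟩ := MeasurableSet.univ.exists_isCompact_sdiff_lt
      (measure_ne_top μ Set.univ) (ε := ((n : ℝ≥0∞) + 1)⁻¹) (by simp)
    exact ⟨K, hK, by rwa [Set.compl_eq_univ_sdiff]⟩
  choose K hK hμK using h
  refine ⟨⋃ n, K n, .iUnion fun n => (hK n).isSeparable, ?_⟩
  have hlim : Tendsto (fun n : ℕ => ((n : ℝ≥0∞) + 1)⁻¹) atTop (𝓝 0) := by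
    have h := ENNReal.tendsto_inv_nat_nhds_zero.comp (tendsto_add_atTop_nat 1)
    simpa [Function.comp_def] using h
  exact le_antisymm (ge_of_tendsto' hlim fun n =>
    (measure_mono (Set.compl_subset_compl.2 (Set.subset_iUnion K n))).trans (hμK n).le) zero_le

variable [NormedSpace ℝ E]

/-- A Radon measure whose characteristic functional is the product of those of `ρ` and `ν`
is the distribution of the sum of independent random vectors with distributions `ρ` and `ν`. -/
theorem integral_integral_add_eq_of_charFunDual_mul [BorelSpace E] [CompleteSpace E]
    {ρ ν μ : Measure E}
    [IsFiniteMeasure ρ] [IsFiniteMeasure ν] [IsFiniteMeasure μ]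
    [ρ.InnerRegular] [ν.InnerRegular] [μ.InnerRegular]
    (h : ∀ L, charFunDual ρ L * charFunDual ν L = charFunDual μ L) (f : E →ᵇ ℝ) :
    ∫ x, ∫ y, f (x + y) ∂ν ∂ρ = ∫ x, f x ∂μ := by
  obtain ⟨s₁, hs₁, h₁⟩ := exists_isSeparable_measure_compl_eq_zero ρ
  obtain ⟨s₂, hs₂, h₂⟩ := exists_isSeparable_measure_compl_eq_zero ν
  obtain ⟨s₃, hs₃, h₃⟩ := exists_isSeparable_measure_compl_eq_zero μ
  -- A closed separable subspace carrying all three measures; there characteristic functionals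
  -- determine measures.
  set F : Submodule ℝ E := (Submodule.span ℝ (s₁ ∪ s₂ ∪ s₃)).topologicalClosure with hF
  have hFs : s₁ ∪ s₂ ∪ s₃ ⊆ (F : Set E) :=
    Submodule.subset_span.trans (Submodule.le_topologicalClosure _)
  have hFclosed : IsClosed (F : Set E) := Submodule.isClosed_topologicalClosure _
  have hFsep : TopologicalSpace.IsSeparable (F : Set E) := by
    rw [hF, Submodule.topologicalClosure_coe]
    exact (((hs₁.union hs₂).union hs₃).span (R := ℝ)).closure
  have : TopologicalSpace.SeparableSpace F := hFsep.separableSpace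
  have : SecondCountableTopology F := UniformSpace.secondCountable_of_separable F
  have : CompleteSpace F := hFclosed.completeSpace_coe
  have hemb : MeasurableEmbedding ((↑) : F → E) :=
    MeasurableEmbedding.subtype_coe hFclosed.measurableSet
  have hmap (m : Measure E) {s : Set E} (hs : m sᶜ = 0) (hsF : s ⊆ F) :
      (m.comap ((↑) : F → E)).map (F.subtypeL) = m := by
    have : (m.comap ((↑) : F → E)).map ((↑) : F → E) = m := by
      rw [hemb.map_comap, Subtype.range_coe, Measure.restrict_eq_self_of_ae_mem]
      exact measure_mono_null (Set.compl_subset_compl.2 hsF) hs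
    exact this
  have hρ := hmap ρ h₁ fun x hx => hFs (Or.inl (Or.inl hx))
  have hν := hmap ν h₂ fun x hx => hFs (Or.inl (Or.inr hx))
  have hμ := hmap μ h₃ fun x hx => hFs (Or.inr hx)
  have hfin (m : Measure E) [IsFiniteMeasure m] : IsFiniteMeasure (m.comap ((↑) : F → E)) :=
    ⟨by rw [hemb.comap_apply]; exact measure_lt_top _ _⟩
  have := hfin ρ
  have := hfin ν
  have := hfin μ
  set ρ' := ρ.comap ((↑) : F → E)
  set ν' := ν.comap ((↑) : F → E)
  set μ' := μ.comap ((↑) : F → E)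
  have hconv : ρ' ∗ ν' = μ' := by
    refine Measure.ext_of_charFunDual (funext fun L => ?_)
    -- Hahn–Banach: functionals on F extend to E, where the hypothesis is available.
    obtain ⟨g, hg, -⟩ := exists_extension_norm_eq F L
    have hg' : g.comp F.subtypeL = L := ContinuousLinearMap.ext hg
    have hchar := h g
    rw [← hρ, ← hν, ← hμ] at hchar
    simp only [charFunDual_map, hg'] at hchar
    rw [charFunDual_conv, hchar]
  have hint : Integrable (fun x : F => f x) (ρ' ∗ ν') :=
    (f.compContinuous ⟨((↑) : F → E), continuous_subtype_val⟩).integrable _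
  have hcalc := integral_conv hint
  rw [hconv] at hcalc
  have hf' : ∫ x, f x ∂μ = ∫ x, f x ∂μ' := by
    conv_lhs => rw [← hμ]
    exact hemb.integral_map _
  rw [hf', hcalc]
  conv_lhs => rw [← hρ]
  refine (hemb.integral_map _).trans (integral_congr_ae (Eventually.of_forall fun x => ?_))
  change ∫ y, f (x + y) ∂ν = ∫ y : F, f (x + y) ∂ν'
  conv_lhs => rw [← hν]
  exact hemb.integral_map _

end Radon

/-! ### Centred Gaussian measures and the closed range of the covariance. -/

section Gaussian

variable {E : Type*} [NormedAddCommGroup E] [NormedSpace ℝ E] [MeasurableSpace E] [BorelSpace E]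
  {μ : Measure E} {R : StrongDual ℝ E →L[ℝ] E}

namespace IsCenteredGaussianRadon

omit [BorelSpace E] in
theorem integral_sq (h : IsCenteredGaussianRadon μ R) (f : StrongDual ℝ E) :
    ∫ x, f x ^ 2 ∂μ = f (R f) := by
  rw [h.covariance]
  simp [sq]

omit [BorelSpace E] in
theorem covariance_nonneg (h : IsCenteredGaussianRadon μ R) (f : StrongDual ℝ E) :
    0 ≤ f (R f) := by
  rw [← h.integral_sq]
  exact integral_nonneg fun x => sq_nonneg _

theorem variance_eq (h : IsCenteredGaussianRadon μ R) (f : StrongDual ℝ E) :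
    Var[f; μ] = f (R f) := by
  have := h.isGaussian
  rw [variance_of_integral_eq_zero (by fun_prop) (h.centered f), h.integral_sq]

theorem charFunDual_eq (h : IsCenteredGaussianRadon μ R) (f : StrongDual ℝ E) :
    charFunDual μ f = Complex.exp (-(f (R f) : ℂ) / 2) := by
  have := h.isGaussian
  rw [IsGaussian.charFunDual_eq, h.variance_eq, integral_complex_ofReal, h.centered]
  congr 1
  push_cast
  ring

theorem map_eq (h : IsCenteredGaussianRadon μ R) (f : StrongDual ℝ E) :
    μ.map f = gaussianReal 0 (f (R f)).toNNReal := by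
  rw [h.isGaussian.map_eq_gaussianReal, h.centered, h.variance_eq]

theorem integral_exp (h : IsCenteredGaussianRadon μ R) (f : StrongDual ℝ E) :
    ∫ x, Real.exp (f x) ∂μ = Real.exp (f (R f) / 2) := by
  have := mgf_gaussianReal (h.map_eq f) 1
  simpa [mgf, h.covariance_nonneg f] using this

theorem integrable_exp (h : IsCenteredGaussianRadon μ R) (f : StrongDual ℝ E) :
    Integrable (fun x => Real.exp (f x)) μ := by
  -- A non-integrable function has integral 0 by convention, but the value in `integral_exp` is
  -- positive.
  refine not_not.1 fun hn => (Real.exp_pos (f (R f) / 2)).ne ?_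
  rw [← h.integral_exp, integral_undef hn]

theorem ae_eq_zero (h : IsCenteredGaussianRadon μ R) {f : StrongDual ℝ E} (hf : f (R f) = 0) :
    f =ᵐ[μ] 0 := by
  have := h.isGaussian
  rw [← h.integral_sq, integral_eq_zero_iff_of_nonneg (fun x => sq_nonneg (f x))
    (IsGaussian.memLp_dual μ f 2 (by simp)).integrable_sq] at hf
  filter_upwards [hf] with x hx using by simpa using hx

theorem covariance_apply_of_sub_eq_zero (h : IsCenteredGaussianRadon μ R)
    {f g : StrongDual ℝ E} (hfg : (f - g) (R (f - g)) = 0) : f (R f) = g (R g) := by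
  rw [← h.integral_sq, ← h.integral_sq]
  refine integral_congr_ae ?_
  filter_upwards [h.ae_eq_zero hfg] with x hx
  have : f x = g x := sub_eq_zero.1 hx
  rw [this]

/-- Membership in the closure of the range of the covariance operator. -/
theorem mem_closure_range_iff (h : IsCenteredGaussianRadon μ R) (x : E) :
    x ∈ (LinearMap.range R.toLinearMap).topologicalClosure ↔
      ∀ f : StrongDual ℝ E, f (R f) = 0 → f x = 0 := by
  constructor
  · intro hx f hf
    have hle : LinearMap.range R.toLinearMap ≤ LinearMap.ker f.toLinearMap := by
      rintro _ ⟨g, rfl⟩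
      change f (R g) = 0
      rw [h.covariance]
      refine integral_eq_zero_of_ae ?_
      filter_upwards [h.ae_eq_zero hf] with x hx
      simp [hx]
    exact Submodule.topologicalClosure_minimal _ hle f.isClosed_ker hx
  · intro hx
    by_contra hx'
    obtain ⟨f, u, hu, hux⟩ := geometric_hahn_banach_closed_point
      (LinearMap.range R.toLinearMap).topologicalClosure.convex
      (Submodule.isClosed_topologicalClosure _) hx'
    have hzero : ∀ y ∈ LinearMap.range R.toLinearMap, f y = 0 := by
      intro y hy
      by_contra hne
      -- This multiple of y has f-value u + 1, violating the bound u on the subspace.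
      have h1 := hu (((u + 1) / f y) • y)
        (Submodule.le_topologicalClosure _ (Submodule.smul_mem _ _ hy))
      rw [map_smul, smul_eq_mul, div_mul_cancel₀ _ hne] at h1
      linarith
    have hu0 : 0 < u := by
      simpa using hu 0 (Submodule.zero_mem _)
    have := hx f (hzero _ ⟨f, rfl⟩)
    linarith

end IsCenteredGaussianRadon

end Gaussian

/-! ### The cocycle identity for the covariances. -/

section Covariance

variable {E : Type*} [NormedAddCommGroup E] [NormedSpace ℝ E]
  {H : Type*} [NormedAddCommGroup H]

/-- The norm is a supremum of continuous functions. This gives measurability of s ↦ ‖g∘S(s)∘B‖,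
where S is only strongly continuous. -/
theorem lowerSemicontinuous_opNorm [NormedSpace ℝ H] {X : Type*} [TopologicalSpace X]
    {φ : X → StrongDual ℝ H} (hφ : ∀ h, Continuous fun x => φ x h) :
    LowerSemicontinuous fun x => ‖φ x‖ := by
  intro x a ha
  obtain ⟨h, hh, hlt⟩ := (φ x).exists_lt_apply_of_lt_opNorm ha
  filter_upwards [(hφ h).norm.continuousAt.eventually_const_lt hlt] with y hy
  refine hy.trans_le (((φ y).le_opNorm h).trans ?_)
  exact mul_le_of_le_one_right (norm_nonneg _) hh.le

variable [InnerProductSpace ℝ H] [CompleteSpace H]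

theorem apply_noiseCov (B : H →L[ℝ] E) (f : StrongDual ℝ E) :
    f (noiseCov B f) = ‖f.comp B‖ ^ 2 := by
  have h := InnerProductSpace.toDual_symm_apply (𝕜 := ℝ)
    (x := (InnerProductSpace.toDual ℝ H).symm (f.comp B)) (y := f.comp B)
  rw [real_inner_self_eq_norm_sq, LinearIsometryEquiv.norm_map] at h
  exact h.symm

variable [CompleteSpace E]

omit [CompleteSpace H] in
theorem intervalIntegrable_norm_comp_sq (S : C0Semigroup E) (B : H →L[ℝ] E) (g : StrongDual ℝ E)
    (a b : ℝ) :
    IntervalIntegrable (fun s : ℝ => ‖(g.comp (S s.toNNReal)).comp B‖ ^ 2) volume a b := by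
  have hmeas : Measurable fun s : ℝ => ‖(g.comp (S s.toNNReal)).comp B‖ ^ 2 :=
    (lowerSemicontinuous_opNorm (φ := fun s : ℝ => (g.comp (S s.toNNReal)).comp B) fun h =>
      g.continuous.comp (S.continuous_toNNReal_apply (B h))).measurable.pow_const 2
  obtain ⟨M, hM⟩ := S.exists_bound (max a b).toNNReal
  have hM0 : 0 ≤ M := (norm_nonneg _).trans (hM 0 zero_le)
  rw [intervalIntegrable_iff]
  refine Measure.integrableOn_of_bounded (M := (‖g‖ * M * ‖B‖) ^ 2) (by simp)
    hmeas.aestronglyMeasurable ?_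
  refine (ae_restrict_iff' measurableSet_uIoc).2 (Eventually.of_forall fun s hs => ?_)
  have hs' : s.toNNReal ≤ (max a b).toNNReal := Real.toNNReal_le_toNNReal hs.2
  rw [norm_pow, norm_norm]
  gcongr
  calc ‖(g.comp (S s.toNNReal)).comp B‖ ≤ ‖g.comp (S s.toNNReal)‖ * ‖B‖ :=
        ContinuousLinearMap.opNorm_comp_le _ _
    _ ≤ ‖g‖ * ‖S s.toNNReal‖ * ‖B‖ := by
        gcongr; exact ContinuousLinearMap.opNorm_comp_le _ _
    _ ≤ ‖g‖ * M * ‖B‖ := by gcongr; exact hM _ hs'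

omit [CompleteSpace E] in
theorem IsOUCovariance.apply_self {S : C0Semigroup E} {B : H →L[ℝ] E} {t : ℝ≥0}
    {R : StrongDual ℝ E →L[ℝ] E} (hR : IsOUCovariance S B t R) (g : StrongDual ℝ E) :
    g (R g) = ∫ s in (0 : ℝ)..t, ‖(g.comp (S s.toNNReal)).comp B‖ ^ 2 := by
  rw [hR]
  exact intervalIntegral.integral_congr fun s _ => apply_noiseCov B (g.comp (S s.toNNReal))

theorem covariance_add {S : C0Semigroup E} {B : H →L[ℝ] E} {Q : ℝ≥0 → StrongDual ℝ E →L[ℝ] E}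
    (hQ : ∀ t, IsOUCovariance S B t (Q t)) (t r : ℝ≥0) (g : StrongDual ℝ E) :
    g (Q (r + t) g) = g (Q t g) + (g.comp (S t)) (Q r (g.comp (S t))) := by
  rw [(hQ _).apply_self, (hQ _).apply_self, (hQ _).apply_self]
  have h : ∫ s in (0 : ℝ)..r, ‖((g.comp (S t)).comp (S s.toNNReal)).comp B‖ ^ 2
      = ∫ s in (0 : ℝ)..r, ‖(g.comp (S (s + t).toNNReal)).comp B‖ ^ 2 := by
    refine intervalIntegral.integral_congr fun s hs => ?_
    rw [Set.uIcc_of_le r.coe_nonneg] at hs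
    rw [Real.toNNReal_add hs.1 t.coe_nonneg, Real.toNNReal_coe, add_comm, S.map_add',
      ContinuousLinearMap.comp_assoc g]
  rw [h, intervalIntegral.integral_comp_add_right
    (fun s => ‖(g.comp (S s.toNNReal)).comp B‖ ^ 2), zero_add,
    intervalIntegral.integral_add_adjacent_intervals, NNReal.coe_add]
  · exact intervalIntegrable_norm_comp_sq S B g _ _
  · exact intervalIntegrable_norm_comp_sq S B g _ _

/-- In probabilistic terms: if X ~ μ∞ and Y ~ μ_t are independent, then S(t)X + Y ~ μ∞. -/
theorem covariance_limit_eq {S : C0Semigroup E} {B : H →L[ℝ] E}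
    {Q : ℝ≥0 → StrongDual ℝ E →L[ℝ] E} {Qinf : StrongDual ℝ E →L[ℝ] E}
    (hQ : ∀ t, IsOUCovariance S B t (Q t))
    (hQinf : ∀ f g : StrongDual ℝ E, Tendsto (fun t => g (Q t f)) atTop (𝓝 (g (Qinf f))))
    (t : ℝ≥0) (g : StrongDual ℝ E) :
    g (Qinf g) = g (Q t g) + (g.comp (S t)) (Qinf (g.comp (S t))) := by
  have h1 : Tendsto (fun r => g (Q (r + t) g)) atTop (𝓝 (g (Qinf g))) :=
    (hQinf g g).comp (tendsto_atTop_mono (fun r => le_add_of_nonneg_right zero_le) tendsto_id)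
  have h2 := (hQinf (g.comp (S t)) (g.comp (S t))).const_add (g (Q t g))
  simp only [← covariance_add hQ] at h2
  exact tendsto_nhds_unique h1 h2

end Covariance

/-! ### Invariance, contractivity and extension to L¹. -/

section Mehler

variable {E : Type*} [NormedAddCommGroup E] [NormedSpace ℝ E] [MeasurableSpace E] [BorelSpace E]

theorem continuous_integral_comp_add (T : E →L[ℝ] E) (μ : Measure E) [IsFiniteMeasure μ]
    (f : E →ᵇ ℝ) : Continuous fun x => ∫ y, f (T x + y) ∂μ := by
  refine continuous_of_dominated (bound := fun _ => ‖f‖) (fun x => ?_)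
    (fun x => Eventually.of_forall fun y => f.norm_coe_le_norm _) (integrable_const _)
    (Eventually.of_forall fun y => by fun_prop)
  exact (by fun_prop : Continuous fun y => f (T x + y)).measurable.aestronglyMeasurable

theorem integrable_comp_add (T : E →L[ℝ] E) (μ : Measure E) [IsFiniteMeasure μ]
    (f : E →ᵇ ℝ) (x : E) : Integrable (fun y => f (T x + y)) μ :=
  (f.compContinuous ⟨fun y => T x + y, by fun_prop⟩).integrable _

/-- The operator `f ↦ ∫ f (T x + y) dμ(y)` on bounded continuous functions. -/
noncomputable def mehler (T : E →L[ℝ] E) (μ : Measure E) [IsProbabilityMeasure μ] :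
    (E →ᵇ ℝ) →ₗ[ℝ] (E →ᵇ ℝ) where
  toFun f := BoundedContinuousFunction.ofNormedAddCommGroup (fun x => ∫ y, f (T x + y) ∂μ)
    (continuous_integral_comp_add T μ f) ‖f‖ fun x => by
      simpa using norm_integral_le_of_norm_le_const (μ := μ)
        (Eventually.of_forall fun y => f.norm_coe_le_norm (T x + y))
  map_add' f g := by
    ext x
    exact integral_add (integrable_comp_add T μ f x) (integrable_comp_add T μ g x)
  map_smul' c f := by
    ext x
    exact integral_const_mul c _

omit [NormedSpace ℝ E] in
theorem norm_toLp_one_eq (ν : Measure E) [IsFiniteMeasure ν] (f : E →ᵇ ℝ) :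
    ‖BoundedContinuousFunction.toLp 1 ν ℝ f‖ = ∫ x, ‖f x‖ ∂ν := by
  rw [L1.norm_eq_integral_norm]
  refine integral_congr_ae ?_
  filter_upwards [BoundedContinuousFunction.coeFn_toLp (p := 1) (𝕜 := ℝ) ν f] with x hx
  rw [hx]

variable {T : E →L[ℝ] E} {μ ν : Measure E} {R Q : StrongDual ℝ E →L[ℝ] E}

/-- The measure `ν` is invariant for the operator `f ↦ ∫ f (T x + y) dμ(y)`. -/
theorem integral_integral_comp_add [CompleteSpace E] (hμ : IsCenteredGaussianRadon μ R)
    (hν : IsCenteredGaussianRadon ν Q)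
    (hRQ : ∀ g : StrongDual ℝ E, g (Q g) = g (R g) + (g.comp T) (Q (g.comp T)))
    (f : E →ᵇ ℝ) : ∫ x, ∫ y, f (T x + y) ∂μ ∂ν = ∫ x, f x ∂ν := by
  have := hμ.isGaussian
  have := hν.isGaussian
  have := hμ.radon
  have := hν.radon
  have := Measure.InnerRegular.map_of_continuous (μ := ν) T.continuous
  rw [← integral_integral_add_eq_of_charFunDual_mul (ρ := ν.map T) (ν := μ) (μ := ν), integral_map]
  · exact T.continuous.aemeasurable
  · have h := continuous_integral_comp_add (ContinuousLinearMap.id ℝ E) μ f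
    exact h.measurable.aestronglyMeasurable
  · intro g
    rw [charFunDual_map, hμ.charFunDual_eq, hν.charFunDual_eq, hν.charFunDual_eq, hRQ g,
      ← Complex.exp_add]
    congr 1
    push_cast
    ring

/-- Pointwise |Pf| ≤ P|f|; integrate and use invariance. -/
theorem norm_toLp_mehler_le [CompleteSpace E] [IsProbabilityMeasure μ] [IsFiniteMeasure ν]
    (hμ : IsCenteredGaussianRadon μ R) (hν : IsCenteredGaussianRadon ν Q)
    (hRQ : ∀ g : StrongDual ℝ E, g (Q g) = g (R g) + (g.comp T) (Q (g.comp T)))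
    (f : E →ᵇ ℝ) : ‖BoundedContinuousFunction.toLp 1 ν ℝ (mehler T μ f)‖ ≤
      ‖BoundedContinuousFunction.toLp 1 ν ℝ f‖ := by
  let f' : E →ᵇ ℝ := f.normComp
  have h := integral_integral_comp_add hμ hν hRQ f'
  rw [norm_toLp_one_eq, norm_toLp_one_eq, show ∫ x, ‖f x‖ ∂ν = ∫ x, f' x ∂ν from rfl, ← h]
  refine integral_mono ?_ ((mehler T μ f').integrable ν) fun x => norm_integral_le_integral_norm _
  exact (mehler T μ f).integrable ν |>.norm

theorem exists_extendsOU [CompleteSpace E] {S : C0Semigroup E} {t : ℝ≥0}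
    (hμ : IsCenteredGaussianRadon μ R) (hν : IsCenteredGaussianRadon ν Q)
    (hRQ : ∀ g : StrongDual ℝ E, g (Q g) = g (R g) + (g.comp (S t)) (Q (g.comp (S t)))) :
    ∃ P : Lp ℝ 1 ν →L[ℝ] Lp ℝ 1 ν, ExtendsOU S t μ ν P ∧ ‖P‖ ≤ 1 := by
  have := hμ.isGaussian
  have := hν.isGaussian
  have hdense := BoundedContinuousFunction.toLp_denseRange (α := E) (p := 1) (μ := ν) ℝ ℝ (by simp)
  have hle := norm_toLp_mehler_le hμ hν hRQ
  let e : (E →ᵇ ℝ) →ₗ[ℝ] Lp ℝ 1 ν := (BoundedContinuousFunction.toLp 1 ν ℝ).toLinearMap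
  let P := (e.comp (mehler (S t) μ)).extendOfNorm e
  refine ⟨P, fun f u hu => ?_, LinearMap.opNorm_extendOfNorm_le hdense zero_le_one
    fun f => by simpa using! hle f⟩
  have hu' : u = e f :=
    Lp.ext (hu.trans (BoundedContinuousFunction.coeFn_toLp (p := 1) (𝕜 := ℝ) ν f).symm)
  have hP : P (e f) = e (mehler (S t) μ f) :=
    LinearMap.extendOfNorm_eq hdense ⟨1, fun f => by simpa using! hle f⟩ f
  rw [hu', hP]
  exact BoundedContinuousFunction.coeFn_toLp (p := 1) (𝕜 := ℝ) ν (mehler (S t) μ f)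

theorem ExtendsOU.unique {S : C0Semigroup E} {t : ℝ≥0} [IsFiniteMeasure ν]
    {P P' : Lp ℝ 1 ν →L[ℝ] Lp ℝ 1 ν}
    (hP : ExtendsOU S t μ ν P) (hP' : ExtendsOU S t μ ν P') : P = P' := by
  have hdense := BoundedContinuousFunction.toLp_denseRange (α := E) (p := 1) (μ := ν) ℝ ℝ (by simp)
  refine DFunLike.coe_injective (hdense.equalizer P.continuous P'.continuous (funext fun f => ?_))
  have hf := BoundedContinuousFunction.coeFn_toLp (p := 1) (𝕜 := ℝ) ν f
  exact Lp.ext ((hP f _ hf).trans (hP' f _ hf).symm)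

end Mehler

/-! ### Action on exponentials and the Hellinger bound. -/

section Exponential

theorem tendsto_Lp_one_of_dominated {α : Type*} [MeasurableSpace α] {ν : Measure α}
    {F : ℕ → Lp ℝ 1 ν} {f : Lp ℝ 1 ν} {bound : α → ℝ} (hbound : Integrable bound ν)
    (hF : ∀ n, ∀ᵐ x ∂ν, ‖F n x‖ ≤ bound x)
    (hlim : ∀ᵐ x ∂ν, Tendsto (fun n => F n x) atTop (𝓝 (f x))) :
    Tendsto F atTop (𝓝 f) := by
  rw [tendsto_iff_norm_sub_tendsto_zero]
  have hnorm (n : ℕ) : ‖F n - f‖ = ∫ x, ‖F n x - f x‖ ∂ν := by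
    rw [L1.norm_eq_integral_norm]
    refine integral_congr_ae ?_
    filter_upwards [Lp.coeFn_sub (F n) f] with x hx
    rw [hx, Pi.sub_apply]
  simp only [hnorm]
  have hf := L1.integrable_coeFn f
  have h := tendsto_integral_of_dominated_convergence (μ := ν)
    (F := fun n x => ‖F n x - f x‖) (f := fun _ => 0) (fun x => bound x + ‖f x‖)
    (fun n => ((L1.integrable_coeFn (F n)).sub hf).aestronglyMeasurable.norm)
    (hbound.add hf.norm) (fun n => ?_) ?_
  · simpa using h
  · filter_upwards [hF n] with x hx
    rw [norm_norm]
    exact (norm_sub_le _ _).trans (by gcongr)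
  · filter_upwards [hlim] with x hx
    simpa using (hx.sub_const (f x)).norm

variable {E : Type*} [NormedAddCommGroup E] [NormedSpace ℝ E] [MeasurableSpace E] [BorelSpace E]
  {μ ν : Measure E} {R Q : StrongDual ℝ E →L[ℝ] E}

/-- The exponential `exp (g - ⟨Q g, g⟩ / 2)`: the density of a translate of the centred Gaussian
measure with covariance `Q`. -/
noncomputable def wickExp (Q : StrongDual ℝ E →L[ℝ] E) (g : StrongDual ℝ E) (x : E) : ℝ :=
  Real.exp (g x - g (Q g) / 2)

omit [MeasurableSpace E] [BorelSpace E] in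
theorem wickExp_pos (Q : StrongDual ℝ E →L[ℝ] E) (g : StrongDual ℝ E) (x : E) :
    0 < wickExp Q g x := Real.exp_pos _

omit [MeasurableSpace E] [BorelSpace E] in
theorem continuous_wickExp (Q : StrongDual ℝ E →L[ℝ] E) (g : StrongDual ℝ E) :
    Continuous (wickExp Q g) := by
  unfold wickExp
  fun_prop

namespace IsCenteredGaussianRadon

theorem integrable_wickExp (h : IsCenteredGaussianRadon ν Q) (g : StrongDual ℝ E) :
    Integrable (wickExp Q g) ν := by
  have := (h.integrable_exp g).div_const (Real.exp (g (Q g) / 2))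
  simp only [← Real.exp_sub] at this
  exact this

theorem integral_wickExp (h : IsCenteredGaussianRadon ν Q) (g : StrongDual ℝ E) :
    ∫ x, wickExp Q g x ∂ν = 1 := by
  simp only [wickExp, Real.exp_sub]
  rw [integral_div, h.integral_exp, div_self (Real.exp_ne_zero _)]

theorem norm_toL1_wickExp (h : IsCenteredGaussianRadon ν Q) (g : StrongDual ℝ E) :
    ‖(h.integrable_wickExp g).toL1‖ = 1 := by
  rw [L1.norm_of_fun_eq_integral_norm, ← h.integral_wickExp g]
  exact integral_congr_ae (Eventually.of_forall fun x => abs_of_pos (wickExp_pos Q g x))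

/-- The Hellinger lower bound for the total variation distance between two translates of a
Gaussian measure. -/
theorem le_norm_toL1_wickExp_sub (h : IsCenteredGaussianRadon ν Q) (a b : StrongDual ℝ E) :
    2 - 2 * Real.exp (-((a - b) (Q (a - b))) / 8) ≤
      ‖(h.integrable_wickExp a).toL1 - (h.integrable_wickExp b).toL1‖ := by
  -- The integrand is √(uv) for the densities u, v of a and b. The bound is |u - v| ≥ (√u - √v)²,
  -- and the parallelogram law for q gives ∫√(uv) = exp(-q(a - b)/8).
  have hmid : Integrable (fun x => Real.exp (((1 / 2 : ℝ) • (a + b)) x) *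
      Real.exp (-(a (Q a) + b (Q b)) / 4)) ν := (h.integrable_exp _).mul_const _
  rw [← Integrable.toL1_sub, L1.norm_of_fun_eq_integral_norm]
  have hlhs : ∫ x, (wickExp Q a x + wickExp Q b x - 2 * (Real.exp (((1 / 2 : ℝ) • (a + b)) x) *
      Real.exp (-(a (Q a) + b (Q b)) / 4))) ∂ν = 2 - 2 * Real.exp (-((a - b) (Q (a - b))) / 8) := by
    have hadd : Integrable (fun x => wickExp Q a x + wickExp Q b x) ν :=
      (h.integrable_wickExp a).add (h.integrable_wickExp b)
    rw [integral_sub hadd (hmid.const_mul 2),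
      integral_add (h.integrable_wickExp a) (h.integrable_wickExp b), h.integral_wickExp,
      h.integral_wickExp, integral_const_mul, integral_mul_const, h.integral_exp, ← Real.exp_add]
    norm_num
    simp
    ring
  rw [← hlhs]
  refine integral_mono (((h.integrable_wickExp a).add (h.integrable_wickExp b)).sub
    (hmid.const_mul 2)) ((h.integrable_wickExp a).sub (h.integrable_wickExp b)).norm fun x => ?_
  have hsplit : Real.exp (((1 / 2 : ℝ) • (a + b)) x) * Real.exp (-(a (Q a) + b (Q b)) / 4)
      = Real.exp ((a x - a (Q a) / 2) / 2) * Real.exp ((b x - b (Q b) / 2) / 2) := by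
    rw [← Real.exp_add, ← Real.exp_add]
    congr 1
    simp
    ring
  have hsq (c : ℝ) : Real.exp c = Real.exp (c / 2) ^ 2 := by
    rw [← Real.exp_nat_mul]
    congr 1
    push_cast
    ring
  simp only [Pi.sub_apply]
  rw [hsplit, wickExp, wickExp, hsq (a x - a (Q a) / 2), hsq (b x - b (Q b) / 2), Real.norm_eq_abs]
  have hu := Real.exp_pos ((a x - a (Q a) / 2) / 2)
  have hv := Real.exp_pos ((b x - b (Q b) / 2) / 2)
  set u := Real.exp ((a x - a (Q a) / 2) / 2)
  set v := Real.exp ((b x - b (Q b) / 2) / 2)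
  rcases le_total u v with huv | huv
  · refine le_trans ?_ (neg_le_abs _)
    nlinarith
  · refine le_trans ?_ (le_abs_self _)
    nlinarith

end IsCenteredGaussianRadon

/-- The truncation `min (wickExp Q g) n` as a bounded continuous function. -/
noncomputable def truncWickExp (Q : StrongDual ℝ E →L[ℝ] E) (g : StrongDual ℝ E) (n : ℕ) :
    E →ᵇ ℝ :=
  BoundedContinuousFunction.ofNormedAddCommGroup (fun x => min (wickExp Q g x) n)
    ((continuous_wickExp Q g).min continuous_const) n fun x => by
      rw [Real.norm_of_nonneg (le_min (wickExp_pos Q g x).le n.cast_nonneg)]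
      exact min_le_right _ _

omit [MeasurableSpace E] [BorelSpace E] in
theorem truncWickExp_apply (Q : StrongDual ℝ E →L[ℝ] E) (g : StrongDual ℝ E) (n : ℕ) (x : E) :
    truncWickExp Q g n x = min (wickExp Q g x) n := rfl

omit [MeasurableSpace E] [BorelSpace E] in
theorem norm_truncWickExp_le (Q : StrongDual ℝ E →L[ℝ] E) (g : StrongDual ℝ E) (n : ℕ) (x : E) :
    ‖truncWickExp Q g n x‖ ≤ wickExp Q g x := by
  rw [truncWickExp_apply, Real.norm_of_nonneg (le_min (wickExp_pos Q g x).le n.cast_nonneg)]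
  exact min_le_left _ _

omit [MeasurableSpace E] [BorelSpace E] in
theorem tendsto_truncWickExp (Q : StrongDual ℝ E →L[ℝ] E) (g : StrongDual ℝ E) (x : E) :
    Tendsto (fun n => truncWickExp Q g n x) atTop (𝓝 (wickExp Q g x)) := by
  obtain ⟨N, hN⟩ := exists_nat_ge (wickExp Q g x)
  refine tendsto_const_nhds.congr' ?_
  filter_upwards [eventually_ge_atTop N] with n hn
  exact (min_eq_left (hN.trans (by exact_mod_cast hn))).symm

/-- The y-integral contributes exp(⟨Rg, g⟩/2), and `hRQ` turns the remaining constant into the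
normalisation for g∘T. -/
theorem integral_wickExp_comp_add (hμ : IsCenteredGaussianRadon μ R) {T : E →L[ℝ] E}
    (hRQ : ∀ g : StrongDual ℝ E, g (Q g) = g (R g) + (g.comp T) (Q (g.comp T)))
    (g : StrongDual ℝ E) (x : E) :
    Integrable (fun y => wickExp Q g (T x + y)) μ ∧
      ∫ y, wickExp Q g (T x + y) ∂μ = wickExp Q (g.comp T) x := by
  have heq : (fun y => wickExp Q g (T x + y)) =
      fun y => Real.exp (g (T x) - g (Q g) / 2) * Real.exp (g y) := by
    ext y
    rw [wickExp, ← Real.exp_add, map_add]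
    congr 1
    ring
  rw [heq]
  refine ⟨(hμ.integrable_exp g).const_mul _, ?_⟩
  rw [integral_const_mul, hμ.integral_exp, ← Real.exp_add, wickExp, hRQ g]
  congr 1
  simp only [ContinuousLinearMap.comp_apply]
  ring

/-- The Ornstein-Uhlenbeck operators map exponentials to exponentials. -/
theorem ExtendsOU.apply_wickExp {S : C0Semigroup E} {t : ℝ≥0} {P : Lp ℝ 1 ν →L[ℝ] Lp ℝ 1 ν}
    (hP : ExtendsOU S t μ ν P) (hμ : IsCenteredGaussianRadon μ R)
    (hν : IsCenteredGaussianRadon ν Q)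
    (hRQ : ∀ g : StrongDual ℝ E, g (Q g) = g (R g) + (g.comp (S t)) (Q (g.comp (S t))))
    (g : StrongDual ℝ E) :
    P (hν.integrable_wickExp g).toL1 = (hν.integrable_wickExp (g.comp (S t))).toL1 := by
  have := hν.isGaussian
  -- `ExtendsOU` speaks only of bounded functions, so truncate; the images are dominated by the
  -- exponential of g∘S(t).
  let u (n : ℕ) : Lp ℝ 1 ν := BoundedContinuousFunction.toLp 1 ν ℝ (truncWickExp Q g n)
  have hu (n : ℕ) : u n =ᵐ[ν] truncWickExp Q g n := BoundedContinuousFunction.coeFn_toLp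
    (p := 1) (𝕜 := ℝ) ν (truncWickExp Q g n)
  have hPu (n : ℕ) := hP _ _ (hu n)
  have h1 : Tendsto u atTop (𝓝 (hν.integrable_wickExp g).toL1) := by
    refine tendsto_Lp_one_of_dominated (hν.integrable_wickExp g) (fun n => ?_) ?_
    · filter_upwards [hu n] with x hx
      rw [hx]
      exact norm_truncWickExp_le Q g n x
    · filter_upwards [ae_all_iff.2 hu, (hν.integrable_wickExp g).coeFn_toL1] with x hx hx'
      simp only [hx, hx']
      exact tendsto_truncWickExp Q g x
  have h2 : Tendsto (fun n => P (u n)) atTop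
      (𝓝 (hν.integrable_wickExp (g.comp (S t))).toL1) := by
    have hint := integral_wickExp_comp_add hμ hRQ g
    refine tendsto_Lp_one_of_dominated (hν.integrable_wickExp (g.comp (S t))) (fun n => ?_) ?_
    · filter_upwards [hPu n] with x hx
      rw [hx, ← (hint x).2]
      exact norm_integral_le_of_norm_le (hint x).1
        (Eventually.of_forall fun y => norm_truncWickExp_le Q g n _)
    · filter_upwards [ae_all_iff.2 hPu, (hν.integrable_wickExp (g.comp (S t))).coeFn_toL1]
        with x hx hx'
      simp only [hx, hx', ← (hint x).2]
      refine tendsto_integral_of_dominated_convergence _ (fun n => ?_) (hint x).1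
        (fun n => Eventually.of_forall fun y => norm_truncWickExp_le Q g n _)
        (Eventually.of_forall fun y => tendsto_truncWickExp Q g _)
      exact (by fun_prop : Continuous fun y => truncWickExp Q g n (S t x + y)).measurable
        |>.aestronglyMeasurable
  exact tendsto_nhds_unique ((P.continuous.tendsto _).comp h1) h2

end Exponential

/-! ### Separating S(s) from S(t) on the support, and the lower bound 2. -/

section Main

variable {E : Type*} [NormedAddCommGroup E] [NormedSpace ℝ E] [CompleteSpace E]
  [MeasurableSpace E] [BorelSpace E] {S : C0Semigroup E}
  {Q : ℝ≥0 → StrongDual ℝ E →L[ℝ] E} {Qinf : StrongDual ℝ E →L[ℝ] E}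
  {μ : ℝ≥0 → Measure E} {ν : Measure E}

omit [CompleteSpace E] in
-- By `hrel`, q(f∘S(t)) ≤ q(f), so composition with S(t) preserves the functionals of zero variance,
-- whose common kernel is the closed range.
theorem mem_closure_range_of_mem (hμ : ∀ t, IsCenteredGaussianRadon (μ t) (Q t))
    (hν : IsCenteredGaussianRadon ν Qinf)
    (hrel : ∀ t (g : StrongDual ℝ E),
      g (Qinf g) = g (Q t g) + (g.comp (S t)) (Qinf (g.comp (S t))))
    (t : ℝ≥0) {x : E} (hx : x ∈ (LinearMap.range Qinf.toLinearMap).topologicalClosure) :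
    S t x ∈ (LinearMap.range Qinf.toLinearMap).topologicalClosure := by
  rw [hν.mem_closure_range_iff] at hx ⊢
  intro f hf
  refine hx (f.comp (S t)) (le_antisymm ?_ (hν.covariance_nonneg _))
  have := (hμ t).covariance_nonneg f
  have := hrel t f
  linarith

/-- If the part of the generator in the support of the invariant measure has non-empty spectrum,
then distinct operators `S s`, `S t` differ there, as measured by the variance of some
functional: otherwise `S` would be nilpotent on the support. -/
theorem exists_covariance_sub_pos (hμ : ∀ t, IsCenteredGaussianRadon (μ t) (Q t))
    (hν : IsCenteredGaussianRadon ν Qinf)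
    (hQinf : ∀ f g : StrongDual ℝ E, Tendsto (fun t => g (Q t f)) atTop (𝓝 (g (Qinf f))))
    (hrel : ∀ t (g : StrongDual ℝ E),
      g (Qinf g) = g (Q t g) + (g.comp (S t)) (Qinf (g.comp (S t))))
    (hσ : (complexSpectrum (partIn S.generator
      (LinearMap.range Qinf.toLinearMap).topologicalClosure)).Nonempty)
    {s t : ℝ≥0} (hst : s < t) :
    ∃ g : StrongDual ℝ E,
      0 < (g.comp (S t) - g.comp (S s)) (Qinf (g.comp (S t) - g.comp (S s))) := by
  by_contra! h
  obtain ⟨p, rfl⟩ := exists_add_of_le hst.le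
  have hp : 0 < p := by simpa using hst
  have hzero (g : StrongDual ℝ E) := le_antisymm (h g) (hν.covariance_nonneg _)
  -- Apply the vanishing variance to g∘S(np): moving from s + np to s + (n+1)p changes nothing.
  have hperiod (g : StrongDual ℝ E) (n : ℕ) :
      (g.comp (S (s + n * p))) (Qinf (g.comp (S (s + n * p)))) =
        (g.comp (S s)) (Qinf (g.comp (S s))) := by
    induction n with
    | zero => simp
    | succ n ih =>
      rw [← ih]
      have h1 := hν.covariance_apply_of_sub_eq_zero (hzero (g.comp (S (n * p))))
      rw [ContinuousLinearMap.comp_assoc, ContinuousLinearMap.comp_assoc, ← S.map_add',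
        ← S.map_add'] at h1
      rwa [show n * p + (s + p) = s + (n + 1 : ℕ) * p by push_cast; ring, add_comm _ s] at h1
  -- The constant sequence q(g∘S(s+np)) equals q(g) - ⟨Q_{s+np}g, g⟩, which tends to 0.
  have hvanish (g : StrongDual ℝ E) : (g.comp (S s)) (Qinf (g.comp (S s))) = 0 := by
    have hlim : Tendsto (fun n : ℕ => s + n * p) atTop atTop := by
      refine tendsto_atTop_mono (fun n => le_add_of_nonneg_left zero_le) ?_
      exact tendsto_natCast_atTop_atTop.atTop_mul_const hp
    have h1 := ((hQinf g g).comp hlim).const_sub (g (Qinf g))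
    rw [sub_self] at h1
    refine tendsto_nhds_unique (tendsto_const_nhds.congr fun n => ?_) h1
    have h2 := hrel (s + n * p) g
    rw [hperiod] at h2
    simp only [Function.comp_apply]
    linarith
  rw [complexSpectrum_partIn_eq_empty S (Submodule.isClosed_topologicalClosure _)
    (fun t x hx => mem_closure_range_of_mem hμ hν hrel t hx) (s := s) fun x hx => ?_] at hσ
  · exact Set.not_nonempty_empty hσ
  · refine SeparatingDual.eq_zero_of_forall_dual_eq_zero (R := ℝ) fun g => ?_
    exact (hν.mem_closure_range_iff x).1 hx (g.comp (S s)) (hvanish g)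

omit [CompleteSpace E] in
theorem two_le_norm_sub (hμ : ∀ t, IsCenteredGaussianRadon (μ t) (Q t))
    (hν : IsCenteredGaussianRadon ν Qinf)
    (hrel : ∀ t (g : StrongDual ℝ E),
      g (Qinf g) = g (Q t g) + (g.comp (S t)) (Qinf (g.comp (S t))))
    {P : ℝ≥0 → Lp ℝ 1 ν →L[ℝ] Lp ℝ 1 ν} (hP : ∀ t, ExtendsOU S t (μ t) ν (P t))
    {s t : ℝ≥0} {g : StrongDual ℝ E}
    (hg : 0 < (g.comp (S t) - g.comp (S s)) (Qinf (g.comp (S t) - g.comp (S s)))) :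
    2 ≤ ‖P t - P s‖ := by
  set d := (g.comp (S t) - g.comp (S s)) (Qinf (g.comp (S t) - g.comp (S s)))
  have hbound (r : ℝ) : 2 - 2 * Real.exp (-(r ^ 2 * d) / 8) ≤ ‖P t - P s‖ := by
    have h1 := hν.le_norm_toL1_wickExp_sub ((r • g).comp (S t)) ((r • g).comp (S s))
    have h2 : ((r • g).comp (S t) - (r • g).comp (S s))
        (Qinf ((r • g).comp (S t) - (r • g).comp (S s))) = r ^ 2 * d := by
      have hsub : (r • g).comp (S t) - (r • g).comp (S s) = r • (g.comp (S t) - g.comp (S s)) := by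
        ext x
        simp [mul_sub]
      rw [hsub, map_smul, map_smul, smul_apply, smul_eq_mul, smul_eq_mul]
      ring
    rw [h2, ← (hP t).apply_wickExp (hμ t) hν (hrel t), ← (hP s).apply_wickExp (hμ s) hν (hrel s),
      ← sub_apply] at h1
    refine h1.trans (((P t - P s).le_opNorm _).trans ?_)
    rw [hν.norm_toL1_wickExp, mul_one]
  have hlim : Tendsto (fun r : ℝ => 2 - 2 * Real.exp (-(r ^ 2 * d) / 8)) atTop (𝓝 (2 - 2 * 0)) := by
    refine ((Real.tendsto_exp_atBot.comp ?_).const_mul 2).const_sub 2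
    refine Tendsto.atBot_div_const (by norm_num) (tendsto_neg_atTop_atBot.comp ?_)
    exact (tendsto_pow_atTop two_ne_zero).atTop_mul_const hg
  rw [mul_zero, sub_zero] at hlim
  exact le_of_tendsto' hlim hbound

end Main

end OrnsteinUhlenbeck

theorem mainTheorem1
    {E : Type*} [NormedAddCommGroup E] [NormedSpace ℝ E] [CompleteSpace E]
    [MeasurableSpace E] [BorelSpace E]
    {H : Type*} [NormedAddCommGroup H] [InnerProductSpace ℝ H] [CompleteSpace H]
    (S : OrnsteinUhlenbeck.C0Semigroup E) (B : H →L[ℝ] E)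
    (Q : ℝ≥0 → StrongDual ℝ E →L[ℝ] E)
    (hQ : ∀ t, OrnsteinUhlenbeck.IsOUCovariance S B t (Q t))
    (μ : ℝ≥0 → Measure E)
    (hμ : ∀ t, OrnsteinUhlenbeck.IsCenteredGaussianRadon (μ t) (Q t))
    (Qinf : StrongDual ℝ E →L[ℝ] E)
    (hQinf : ∀ f g : StrongDual ℝ E, Tendsto (fun t => g (Q t f)) atTop (𝓝 (g (Qinf f))))
    (μinf : Measure E)
    (hμinf : OrnsteinUhlenbeck.IsCenteredGaussianRadon μinf Qinf)
    (hS : S.EventuallyCompact)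
    (hσ : (OrnsteinUhlenbeck.complexSpectrum (OrnsteinUhlenbeck.partIn S.generator
      (LinearMap.range Qinf.toLinearMap).topologicalClosure)).Nonempty) :
    (∃! P : ℝ≥0 → Lp ℝ 1 μinf →L[ℝ] Lp ℝ 1 μinf,
      ∀ t, OrnsteinUhlenbeck.ExtendsOU S t (μ t) μinf (P t)) ∧
    ∀ P : ℝ≥0 → Lp ℝ 1 μinf →L[ℝ] Lp ℝ 1 μinf,
      (∀ t, OrnsteinUhlenbeck.ExtendsOU S t (μ t) μinf (P t)) →
      ∀ t s : ℝ≥0, t ≠ s → ‖P t - P s‖ = 2 := by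
  have := hμinf.isGaussian
  have hrel := OrnsteinUhlenbeck.covariance_limit_eq hQ hQinf
  choose P hP hnorm using fun t =>
    OrnsteinUhlenbeck.exists_extendsOU (hμ t) hμinf (hrel t)
  have huniq : ∀ P' : ℝ≥0 → Lp ℝ 1 μinf →L[ℝ] Lp ℝ 1 μinf,
      (∀ t, OrnsteinUhlenbeck.ExtendsOU S t (μ t) μinf (P' t)) → P' = P :=
    fun P' hP' => funext fun t => (hP' t).unique (hP t)
  refine ⟨⟨P, hP, huniq⟩, fun P' hP' t s hts => ?_⟩
  rw [huniq P' hP']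
  refine le_antisymm ((norm_sub_le _ _).trans (by linarith [hnorm t, hnorm s])) ?_
  wlog hst : s < t generalizing s t
  · rw [norm_sub_rev]
    exact this s t hts.symm (lt_of_le_of_ne (not_lt.1 hst) hts)
  obtain ⟨g, hg⟩ :=
    OrnsteinUhlenbeck.exists_covariance_sub_pos hμ hμinf hQinf hrel hσ hst
  exact OrnsteinUhlenbeck.two_le_norm_sub hμ hμinf hrel hP hg
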